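/- Let $\ell>0$, let $H$ be an entire function, and put $\nu(z)=e^{\ell(z+z^{-1})/2}H(z)$ for $z\neq 0$. Assume that $d\mu(z)=\frac{\nu(z)}{iz}\,dz$ is a nontrivial positive measure on the unit circle $\mathbb T$, i.e. $\nu$ is real and nonnegative on $\mathbb T$ and not identically zero there. Let $\Phi_n$ ($n\ge 0$) be the monic orthogonal polynomials of $\mu$, $\deg\Phi_n=n$, $$\int_{\mathbb T}\Phi_n(z)\overline{\Phi_m(z)}\,\frac{\nu(z)}{iz}\,dz=\kappa_n^{-2}\delta_{n,m},\qquad \kappa_n>0,$$ and put $\Phi_n^*(z)=z^n\overline{\Phi_n(1/\bar z)}$, $\alpha_{n-1}=-\overline{\Phi_n(0)}$ for $n\ge 1$, $b_n=2\pi\kappa_n^2$, $$G_n(z)=\frac1{2\pi i}\int_{\mathbb T}\frac{\Phi_n(t)}{t-z}\frac{\nu(t)}{t^n}\,dt,\qquad G^*_{n-1}(z)=\frac1{2\pi i}\int_{\mathbb T}\frac{\Phi^*_{n-1}(t)}{t-z}\frac{\nu(t)}{t^n}\,dt .$$ For $n\ge1$ and $z\notin\mathbb T$ let $$Y_n(z)=\begin{bmatrix}\Phi_n(z)&G_n(z)\\-b_{n-1}\Phi^*_{n-1}(z)&-b_{n-1}G^*_{n-1}(z)\end{bmatrix},$$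 and for $z\notin\mathbb T\cup\{0\}$ let $$Z_n(z)=Y_n(z)\begin{bmatrix}z^{-n/2}\nu(z)^{1/2}&0\\0&z^{n/2}\nu(z)^{-1/2}\end{bmatrix},\qquad M_n(z)=Z_n'(z)Z_n(z)^{-1},$$ where near each point of $\mathbb C\setminus(\mathbb T\cup\{0\})$ holomorphic branches of $z^{1/2}$ and $\nu^{1/2}$ exist, and $M_n$ does not depend on their choice. Then, for every $n\ge 1$, $M_n$ extends to a holomorphic matrix function in $\mathbb C\setminus\{0\}$ which has a pole of order exactly $2$ at $z=0$, and $$\lim_{z\to0}z^2M_n(z)=\begin{bmatrix}\frac{\ell}{4}\left(b_{n-1}b_n^{-1}-\alpha_{n-1}^2\right)&-\frac{\ell}{2}b_n^{-1}\alpha_{n-1}\\-\frac{\ell}{2}b_{n-1}\alpha_{n-1}&-\frac{\ell}{4}\left(b_{n-1}b_n^{-1}-\alpha_{n-1}^2\right)\end{bmatrix}\neq 0 .$$ -/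

import Mathlib

open Polynomial Filter Topology

namespace OPUC

/-- `ν` is the density of a nontrivial positive measure `ν(z) dz / (i z)` on the unit circle. -/
structure IsPositiveWeight (ν : ℂ → ℂ) : Prop where
  continuousOn : ContinuousOn ν (Metric.sphere 0 1)
  real : ∀ z ∈ Metric.sphere (0 : ℂ) 1, (ν z).im = 0
  nonneg : ∀ z ∈ Metric.sphere (0 : ℂ) 1, 0 ≤ (ν z).re
  nontrivial : ∃ z ∈ Metric.sphere (0 : ℂ) 1, ν z ≠ 0

/-- `∫_𝕋 p(z) conj(q(z)) ν(z) / (i z) dz`. -/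
noncomputable def pairing (ν : ℂ → ℂ) (p q : ℂ[X]) : ℂ :=
  ∮ z in C(0, 1), p.eval z * (starRingEnd ℂ) (q.eval z) * (ν z / (Complex.I * z))

/-- The monic orthogonal polynomials `Φ_n` of the weight `ν`, by Gram–Schmidt applied to
`1, z, z², …`; the characterizing properties are `monicOP_monic`, `monicOP_natDegree` and
`pairing_monicOP`. -/
noncomputable def monicOP (ν : ℂ → ℂ) (n : ℕ) : ℂ[X] :=
  X ^ n - ∑ k : Fin n, C (pairing ν (X ^ n) (monicOP ν k) /
    pairing ν (monicOP ν k) (monicOP ν k)) * monicOP ν k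
termination_by n
decreasing_by all_goals exact k.2

/-- `κ_n > 0` with `κ_n⁻² = ∫_𝕋 |Φ_n|² dμ`. -/
noncomputable def kappa (ν : ℂ → ℂ) (n : ℕ) : ℝ :=
  (Real.sqrt (pairing ν (monicOP ν n) (monicOP ν n)).re)⁻¹

/-- `b_n = 2 π κ_n²`. -/
noncomputable def b (ν : ℂ → ℂ) (n : ℕ) : ℝ := 2 * Real.pi * kappa ν n ^ 2

theorem monicOP_eq (ν : ℂ → ℂ) (n : ℕ) :
    monicOP ν n = X ^ n - ∑ k : Fin n, C (pairing ν (X ^ n) (monicOP ν k) /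
      pairing ν (monicOP ν k) (monicOP ν k)) * monicOP ν k := by
  rw [monicOP]

theorem monicOP_aux (ν : ℂ → ℂ) (n : ℕ) :
    (monicOP ν n).Monic ∧ (monicOP ν n).natDegree = n := by
  induction n using Nat.strong_induction_on with
  | _ n ih =>
    have hd : (∑ k : Fin n, C (pairing ν (X ^ n) (monicOP ν k) /
        pairing ν (monicOP ν k) (monicOP ν k)) * monicOP ν k).degree < (n : WithBot ℕ) := by
      refine lt_of_le_of_lt (degree_sum_le _ _) ?_
      refine (Finset.sup_lt_iff (WithBot.bot_lt_coe n)).2 fun k _ => ?_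
      refine lt_of_le_of_lt degree_le_natDegree ?_
      refine lt_of_le_of_lt (WithBot.coe_le_coe.2 (natDegree_C_mul_le _ _)) ?_
      rw [(ih k k.2).2]
      exact_mod_cast k.2
    have hm : (monicOP ν n).Monic := by
      rw [monicOP_eq]
      exact monic_X_pow_sub hd
    refine ⟨hm, ?_⟩
    rw [monicOP_eq, sub_eq_add_neg]
    refine natDegree_eq_of_degree_eq_some ?_
    rw [degree_add_eq_left_of_degree_lt, degree_X_pow]
    rwa [degree_neg, degree_X_pow]

theorem monicOP_monic (ν : ℂ → ℂ) (n : ℕ) : (monicOP ν n).Monic := (monicOP_aux ν n).1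

theorem monicOP_natDegree (ν : ℂ → ℂ) (n : ℕ) : (monicOP ν n).natDegree = n :=
  (monicOP_aux ν n).2

theorem pairing_eq (ν : ℂ → ℂ) (p q : ℂ[X]) :
    pairing ν p q = ∫ θ in (0 : ℝ)..2 * Real.pi, p.eval (circleMap 0 1 θ) *
      (starRingEnd ℂ) (q.eval (circleMap 0 1 θ)) * ν (circleMap 0 1 θ) := by
  unfold pairing circleIntegral
  refine intervalIntegral.integral_congr fun θ _ => ?_
  have h : circleMap 0 1 θ ≠ 0 := circleMap_ne_center one_ne_zero
  simp only [deriv_circleMap, smul_eq_mul]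
  field_simp

theorem IsPositiveWeight.continuous_circle {ν : ℂ → ℂ} (hν : IsPositiveWeight ν) :
    Continuous fun θ : ℝ => ν (circleMap 0 1 θ) :=
  hν.continuousOn.comp_continuous (continuous_circleMap 0 1)
    (circleMap_mem_sphere 0 zero_le_one)

theorem continuous_pairing {ν : ℂ → ℂ} (hν : IsPositiveWeight ν) (p q : ℂ[X]) :
    Continuous fun θ : ℝ => p.eval (circleMap 0 1 θ) *
      (starRingEnd ℂ) (q.eval (circleMap 0 1 θ)) * ν (circleMap 0 1 θ) :=
  ((p.continuous.comp (continuous_circleMap 0 1)).mul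
    (Complex.continuous_conj.comp (q.continuous.comp (continuous_circleMap 0 1)))).mul
    hν.continuous_circle

theorem pairing_sub {ν : ℂ → ℂ} (hν : IsPositiveWeight ν) (p q r : ℂ[X]) :
    pairing ν (p - q) r = pairing ν p r - pairing ν q r := by
  rw [pairing_eq, pairing_eq, pairing_eq, ← intervalIntegral.integral_sub
    ((continuous_pairing hν p r).intervalIntegrable _ _)
    ((continuous_pairing hν q r).intervalIntegrable _ _)]
  congr 1; ext θ; simp; ring

theorem pairing_C_mul (ν : ℂ → ℂ) (c : ℂ) (p r : ℂ[X]) :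
    pairing ν (C c * p) r = c * pairing ν p r := by
  rw [pairing_eq, pairing_eq, ← intervalIntegral.integral_const_mul]
  congr 1; ext θ; simp; ring

theorem pairing_sum {ν : ℂ → ℂ} (hν : IsPositiveWeight ν) {ι : Type} (s : Finset ι)
    (f : ι → ℂ[X]) (r : ℂ[X]) :
    pairing ν (∑ k ∈ s, f k) r = ∑ k ∈ s, pairing ν (f k) r := by
  simp only [pairing_eq]
  rw [← intervalIntegral.integral_finsetSum
    fun k _ => (continuous_pairing hν (f k) r).intervalIntegrable _ _]
  congr 1; ext θ; simp [eval_finsetSum, Finset.sum_mul]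

theorem pairing_conj {ν : ℂ → ℂ} (hν : IsPositiveWeight ν) (p q : ℂ[X]) :
    (starRingEnd ℂ) (pairing ν p q) = pairing ν q p := by
  rw [pairing_eq, pairing_eq, ← intervalIntegral.intervalIntegral_conj]
  congr 1; ext θ
  have h : (starRingEnd ℂ) (ν (circleMap 0 1 θ)) = ν (circleMap 0 1 θ) :=
    Complex.conj_eq_iff_im.2 (hν.real _ (circleMap_mem_sphere 0 zero_le_one θ))
  simp only [map_mul, Complex.conj_conj, h]; ring

theorem pairing_self_eq {ν : ℂ → ℂ} (hν : IsPositiveWeight ν) (p : ℂ[X]) :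
    pairing ν p p = ((∫ θ in (0 : ℝ)..2 * Real.pi,
      Complex.normSq (p.eval (circleMap 0 1 θ)) * (ν (circleMap 0 1 θ)).re : ℝ) : ℂ) := by
  rw [pairing_eq, ← intervalIntegral.integral_ofReal]
  congr 1; ext θ
  have h : ν (circleMap 0 1 θ) = ((ν (circleMap 0 1 θ)).re : ℂ) :=
    Complex.ext rfl (hν.real _ (circleMap_mem_sphere 0 zero_le_one θ))
  rw [Complex.mul_conj, h]; simp

theorem pairing_self_pos {ν : ℂ → ℂ} (hν : IsPositiveWeight ν) {p : ℂ[X]} (hp : p ≠ 0) :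
    0 < (pairing ν p p).re := by
  rw [pairing_self_eq hν, Complex.ofReal_re]
  have hc : Continuous fun θ : ℝ =>
      Complex.normSq (p.eval (circleMap 0 1 θ)) * (ν (circleMap 0 1 θ)).re :=
    (Complex.continuous_normSq.comp (p.continuous.comp (continuous_circleMap 0 1))).mul
      (Complex.continuous_re.comp hν.continuous_circle)
  have hnn : ∀ θ : ℝ, 0 ≤ Complex.normSq (p.eval (circleMap 0 1 θ)) * (ν (circleMap 0 1 θ)).re :=
    fun θ => mul_nonneg (Complex.normSq_nonneg _)
      (hν.nonneg _ (circleMap_mem_sphere 0 zero_le_one θ))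
  refine intervalIntegral.integral_pos Real.two_pi_pos hc.continuousOn (fun θ _ => hnn θ) ?_
  by_contra! hcon
  obtain ⟨z, hz, hz0⟩ := hν.nontrivial
  obtain ⟨t, rfl⟩ : ∃ t : ℝ, circleMap 0 1 t = z := by
    have := range_circleMap (0 : ℂ) 1
    rw [abs_one] at this
    rw [← this] at hz
    exact hz
  have hU : IsOpen {θ : ℝ | ν (circleMap 0 1 θ) ≠ 0} :=
    isOpen_ne.preimage hν.continuous_circle
  obtain ⟨ε, hε, hball⟩ := Metric.isOpen_iff.1 hU t hz0
  have hroots : ∀ θ ∈ Metric.ball t ε, circleMap 0 1 θ ∈ (p.roots.toFinset : Set ℂ) := by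
    intro θ hθ
    have hνθ : ν (circleMap 0 1 θ) ≠ 0 := hball hθ
    obtain ⟨θ', hθ', hcm⟩ : ∃ θ' ∈ Set.Ico (0 : ℝ) (0 + 2 * Real.pi),
        circleMap 0 1 θ = circleMap 0 1 θ' :=
      Function.Periodic.exists_mem_Ico (periodic_circleMap 0 1) Real.two_pi_pos θ 0
    have h0 := le_antisymm (hcon θ' ⟨hθ'.1, by linarith [hθ'.2]⟩) (hnn θ')
    rw [← hcm] at h0
    have hre : (ν (circleMap 0 1 θ)).re ≠ 0 := fun h =>
      hνθ (Complex.ext h (hν.real _ (circleMap_mem_sphere 0 zero_le_one θ)))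
    have := (mul_eq_zero.1 h0).resolve_right hre
    simpa [hp] using this
  have hinj : Set.InjOn (circleMap 0 1) (Set.Ioo t (t + min ε Real.pi)) := by
    intro x hx y hy hxy
    have := Real.pi_pos
    have h1 := hx.2.trans_le (add_le_add_right (min_le_right ε Real.pi) t)
    have h2 := hy.2.trans_le (add_le_add_right (min_le_right ε Real.pi) t)
    refine injOn_circleMap_of_abs_sub_le' (c := 0) (R := 1) (a := t) (b := t + Real.pi) one_ne_zero
      (by linarith) ⟨hx.1.le, h1⟩ ⟨hy.1.le, h2⟩ hxy
  have hfin : (Set.Ioo t (t + min ε Real.pi)).Finite := by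
    refine Set.Finite.of_finite_image ((Finset.finite_toSet p.roots.toFinset).subset ?_) hinj
    rintro _ ⟨θ, hθ, rfl⟩
    refine hroots θ ?_
    rw [Metric.mem_ball, Real.dist_eq, abs_lt]
    have := min_le_left ε Real.pi
    constructor <;> linarith [hθ.1, hθ.2]
  exact (Set.Ioo_infinite (by linarith [lt_min hε Real.pi_pos])) hfin

theorem kappa_pos {ν : ℂ → ℂ} (hν : IsPositiveWeight ν) (n : ℕ) : 0 < kappa ν n :=
  inv_pos.2 (Real.sqrt_pos.2 (pairing_self_pos hν (monicOP_monic ν n).ne_zero))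

/-- The orthogonality relations `∫_𝕋 Φ_n conj(Φ_m) dμ = κ_n⁻² δ_{n,m}`. -/
theorem pairing_monicOP {ν : ℂ → ℂ} (hν : IsPositiveWeight ν) (n m : ℕ) :
    pairing ν (monicOP ν n) (monicOP ν m) = if n = m then (((kappa ν n) ^ 2)⁻¹ : ℂ) else 0 := by
  have hself : ∀ k, pairing ν (monicOP ν k) (monicOP ν k) ≠ 0 := fun k h => by
    have := pairing_self_pos hν (monicOP_monic ν k).ne_zero
    rw [h] at this
    simp at this
  have key : ∀ n, ∀ m < n, pairing ν (monicOP ν n) (monicOP ν m) = 0 := by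
    intro n
    induction n using Nat.strong_induction_on with
    | _ n ih =>
      intro m hm
      rw [monicOP_eq ν n, pairing_sub hν, pairing_sum hν, Finset.sum_eq_single ⟨m, hm⟩]
      · rw [pairing_C_mul, div_mul_cancel₀ _ (hself m), sub_self]
      · intro k _ hk
        rw [pairing_C_mul]
        have hkm : (k : ℕ) ≠ m := fun h => hk (Fin.ext h)
        rcases lt_or_gt_of_ne hkm with h | h
        · rw [← pairing_conj hν (monicOP ν m) (monicOP ν k), ih m hm k h, map_zero, mul_zero]
        · rw [ih k k.2 m h, mul_zero]
      · intro h
        exact absurd (Finset.mem_univ _) h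
  split_ifs with h
  · subst h
    have hpos := pairing_self_pos hν (monicOP_monic ν n).ne_zero
    unfold kappa
    rw [← Complex.ofReal_pow, inv_pow, Real.sq_sqrt hpos.le, Complex.ofReal_inv, inv_inv]
    rw [pairing_self_eq hν, Complex.ofReal_re]
  · rcases lt_or_gt_of_ne h with h | h
    · rw [← pairing_conj hν, key m n h, map_zero]
    · exact key n m h

/-- The reciprocal polynomial `Φ_n^*(z) = z^n conj(Φ_n(1 / conj z))`. -/
noncomputable def recipOP (ν : ℂ → ℂ) (n : ℕ) : ℂ[X] :=
  ((monicOP ν n).map (starRingEnd ℂ)).reflect n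

/-- The Verblunsky coefficient `α_n = -conj(Φ_{n+1}(0))`. -/
noncomputable def verblunsky (ν : ℂ → ℂ) (n : ℕ) : ℂ :=
  -(starRingEnd ℂ) ((monicOP ν (n + 1)).eval 0)

/-- The associated function `G_n`. -/
noncomputable def assocG (ν : ℂ → ℂ) (n : ℕ) (z : ℂ) : ℂ :=
  1 / (2 * Real.pi * Complex.I) *
    ∮ t in C(0, 1), (monicOP ν n).eval t / (t - z) * (ν t / t ^ n)

/-- The associated function `G_n^*`; note the power `t ^ (n + 1)`. -/
noncomputable def assocGStar (ν : ℂ → ℂ) (n : ℕ) (z : ℂ) : ℂ :=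
  1 / (2 * Real.pi * Complex.I) *
    ∮ t in C(0, 1), (recipOP ν n).eval t / (t - z) * (ν t / t ^ (n + 1))

/-- The solution `Y_n`, `n ≥ 1`, of the Riemann–Hilbert problem. -/
noncomputable def Y (ν : ℂ → ℂ) (n : ℕ) (z : ℂ) : Matrix (Fin 2) (Fin 2) ℂ :=
  !![(monicOP ν n).eval z, assocG ν n z;
     -(b ν (n - 1) : ℂ) * (recipOP ν (n - 1)).eval z, -(b ν (n - 1) : ℂ) * assocGStar ν (n - 1) z]

/-- `Z` is a branch on the open set `U ⊆ ℂ ∖ (𝕋 ∪ {0})` of the multivalued matrix function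
`Z_n = Y_n C_n`, `C_n = diag(z^{-n/2} ν^{1/2}, z^{n/2} ν^{-1/2})`: here `s` and `r` are holomorphic
branches of `z^{1/2}` and `ν^{1/2}` on `U`. -/
def IsFundamentalBranch (ν : ℂ → ℂ) (n : ℕ) (U : Set ℂ)
    (Z : ℂ → Matrix (Fin 2) (Fin 2) ℂ) : Prop :=
  IsOpen U ∧ (∀ z ∈ U, ‖z‖ ≠ 1 ∧ z ≠ 0) ∧
  ∃ s r : ℂ → ℂ, DifferentiableOn ℂ s U ∧ DifferentiableOn ℂ r U ∧
    (∀ z ∈ U, s z ^ 2 = z) ∧ (∀ z ∈ U, r z ^ 2 = ν z) ∧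
    ∀ z ∈ U, Z z = Y ν n z * !![(s z ^ n)⁻¹ * r z, 0; 0, s z ^ n * (r z)⁻¹]

/-- Entrywise complex derivative of a matrix function. -/
noncomputable def matDeriv (Z : ℂ → Matrix (Fin 2) (Fin 2) ℂ) (z : ℂ) :
    Matrix (Fin 2) (Fin 2) ℂ :=
  Matrix.of fun i j => deriv (fun w => Z w i j) z

/-- `M = Z_n' Z_n⁻¹` on `ℂ ∖ (𝕋 ∪ {0})`: near each such point `Z_n` has a branch, and `M` is
the logarithmic derivative of every branch. -/
def IsStructureMatrix (ν : ℂ → ℂ) (n : ℕ) (M : ℂ → Matrix (Fin 2) (Fin 2) ℂ) : Prop :=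
  ∀ z : ℂ, ‖z‖ ≠ 1 → z ≠ 0 →
    (∃ U Z, z ∈ U ∧ IsFundamentalBranch ν n U Z) ∧
    ∀ U Z, z ∈ U → IsFundamentalBranch ν n U Z → M z = matDeriv Z z * (Z z)⁻¹

/-- The matrix function `M` has a pole of order exactly `k` at `z₀`. -/
def HasPoleOfOrder (M : ℂ → Matrix (Fin 2) (Fin 2) ℂ) (k : ℕ) (z₀ : ℂ) : Prop :=
  0 < k ∧
  (∀ i j, MeromorphicAt (fun z => M z i j) z₀ ∧
    ((-(k : ℤ) : ℤ) : WithTop ℤ) ≤ meromorphicOrderAt (fun z => M z i j) z₀) ∧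
  ∃ i j, meromorphicOrderAt (fun z => M z i j) z₀ = ((-(k : ℤ) : ℤ) : WithTop ℤ)

/-- The generalized modified Bessel weight. -/
noncomputable def besselWeight (l : ℝ) (H : ℂ → ℂ) (z : ℂ) : ℂ :=
  Complex.exp (l * (z + z⁻¹) / 2) * H z

/-- The leading coefficient at `0` of the structure matrix of the modified Bessel weight. -/
noncomputable def besselLeadingCoeff (l : ℝ) (ν : ℂ → ℂ) (n : ℕ) : Matrix (Fin 2) (Fin 2) ℂ :=
  !![(l : ℂ) / 4 * ((b ν (n - 1) : ℂ) * (b ν n : ℂ)⁻¹ - verblunsky ν (n - 1) ^ 2),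
      -((l : ℂ) / 2) * (b ν n : ℂ)⁻¹ * verblunsky ν (n - 1);
     -((l : ℂ) / 2) * (b ν (n - 1) : ℂ) * verblunsky ν (n - 1),
      -((l : ℂ) / 4) * ((b ν (n - 1) : ℂ) * (b ν n : ℂ)⁻¹ - verblunsky ν (n - 1) ^ 2)]

end OPUC

/-!
Since `exp (ℓ (z + z⁻¹) / 2)` is real on the unit circle, so is `H`; the maximum principle for
`exp (± i H)` makes an entire function with real values on the circle constant. Thus `ν` is
zero-free off `0` and invariant under conjugation on the circle.

Deforming the contour continues `Y_n` from the disc to an entire matrix function `X`; outside the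
disc `Y_n = X * [1, -ν / zⁿ; 0, 1]`. The orthogonality relations are the vanishing of moments, which
gives `det Y_n → 1` at infinity, so `det X = 1` by Liouville's theorem. With `u² = ν / zⁿ` the jump
becomes constant: `Z_n` equals `X * diag(u, u⁻¹)` inside the disc and that times `[1, -1; 0, 1]`
outside. A constant right factor does not change the logarithmic derivative, so on both sides
`Z_n' Z_n⁻¹ = (X' + q X σ₃) X⁻¹` with `q = (ν' / ν - n / z) / 2`. As `ν' / ν = ℓ (1 - z⁻²) / 2`, the
function `z² q` is `-ℓ / 4` at `0`, and the leading coefficient is `-ℓ / 4` times the conjugate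
`X(0) σ₃ X(0)⁻¹`, where `X(0)` consists of moments expressed through `α_{n-1}`, `b_{n-1}`, `b_n`.
-/

namespace OPUC

section RealBoundaryValues

variable {f : ℂ → ℂ} {U : Set ℂ}

theorem im_nonneg_of_im_eq_zero_on_frontier (hU : Bornology.IsBounded U) (hf : DiffContOnCl ℂ f U)
    (hreal : ∀ z ∈ frontier U, (f z).im = 0) {z : ℂ} (hz : z ∈ closure U) : 0 ≤ (f z).im := by
  have hexp : ‖Complex.exp (Complex.I * f z)‖ ≤ 1 := by
    refine Complex.norm_le_of_forall_mem_frontier_norm_le hU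
      (Complex.differentiable_exp.comp_diffContOnCl (hf.const_smul Complex.I)) (fun w hw => ?_) hz
    simp [Complex.norm_exp, hreal w hw]
  simpa [Complex.norm_exp] using hexp

theorem im_eq_zero_of_im_eq_zero_on_frontier (hU : Bornology.IsBounded U)
    (hf : DiffContOnCl ℂ f U) (hreal : ∀ z ∈ frontier U, (f z).im = 0) {z : ℂ}
    (hz : z ∈ closure U) : (f z).im = 0 := by
  refine le_antisymm ?_ (im_nonneg_of_im_eq_zero_on_frontier hU hf hreal hz)
  simpa using im_nonneg_of_im_eq_zero_on_frontier hU hf.neg (by simpa using hreal) hz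

theorem eq_const_of_im_eq_zero_on_frontier (hf : Differentiable ℂ f)
    (hU : Bornology.IsBounded U) (hopen : IsOpen U) (hne : U.Nonempty)
    (hreal : ∀ z ∈ frontier U, (f z).im = 0) : ∃ c, f = fun _ => c := by
  obtain ⟨z₀, hz₀⟩ := hne
  obtain ⟨ε, hε, hball⟩ := Metric.isOpen_iff.1 hopen z₀ hz₀
  have hanalytic : AnalyticOnNhd ℂ f Set.univ := fun z _ => hf.analyticAt z
  obtain ⟨c, hc⟩ := (hanalytic.mono (Set.subset_univ (Metric.ball z₀ ε))).eq_const_of_im_eq_const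
    (fun z hz => im_eq_zero_of_im_eq_zero_on_frontier hU hf.diffContOnCl hreal
      (subset_closure (hball hz)))
    Metric.isOpen_ball ((convex_ball z₀ ε).isConnected ⟨z₀, Metric.mem_ball_self hε⟩)
  refine ⟨c, hanalytic.eq_of_eventuallyEq (fun _ _ => analyticAt_const) (z₀ := z₀) ?_⟩
  filter_upwards [Metric.ball_mem_nhds z₀ hε] with w hw using hc w hw

end RealBoundaryValues

theorem exists_isOpen_sq_eq {f : ℂ → ℂ} {U : Set ℂ} (hU : IsOpen U) (hf : DifferentiableOn ℂ f U)
    {z : ℂ} (hz : z ∈ U) (hfz : f z ≠ 0) :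
    ∃ V ⊆ U, IsOpen V ∧ z ∈ V ∧ ∃ g : ℂ → ℂ, DifferentiableOn ℂ g V ∧ ∀ w ∈ V, g w ^ 2 = f w := by
  obtain ⟨c, hc⟩ := IsAlgClosed.exists_pow_nat_eq (f z) two_pos
  refine ⟨U ∩ {w | f w / f z ∈ Complex.slitPlane}, Set.inter_subset_left,
    (hf.div_const (f z)).continuousOn.isOpen_inter_preimage hU Complex.isOpen_slitPlane,
    ⟨hz, by simp [hfz]⟩, fun w => c * (f w / f z) ^ (1 / 2 : ℂ), ?_, fun w _ => ?_⟩
  · exact (((hf.mono Set.inter_subset_left).div_const (f z)).cpow_const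
      fun w hw => hw.2).const_mul c
  · rw [mul_pow, hc, one_div, ← Nat.cast_ofNat (n := 2), Complex.cpow_nat_inv_pow _ two_ne_zero,
      mul_div_cancel₀ _ hfz]

section CauchyTransform

/-- The Cauchy transform `(2πi)⁻¹ ∮ f(t) / (t - z) dt` over the circle `|t| = R`. The functions
`G_n`, `G_n^*` are Cauchy transforms over the unit circle; the other radii serve to continue them
across it. -/
noncomputable def cauchyTransform (R : ℝ) (f : ℂ → ℂ) (z : ℂ) : ℂ :=
  (2 * Real.pi * Complex.I)⁻¹ * ∮ t in C(0, R), f t / (t - z)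

variable {f : ℂ → ℂ} {r R : ℝ} {z : ℂ}

theorem circleIntegral_eq_of_differentiableAt {E : Type*} [NormedAddCommGroup E]
    [NormedSpace ℂ E] {g : ℂ → E} (hr : 0 < r) (hrR : r ≤ R)
    (hg : ∀ t : ℂ, r ≤ ‖t‖ → DifferentiableAt ℂ g t) :
    (∮ t in C(0, R), g t) = ∮ t in C(0, r), g t := by
  refine Complex.circleIntegral_eq_of_differentiable_on_annulus_off_countable hr hrR
    Set.countable_empty (fun t ht => ?_) (fun t ht => ?_)
  · exact (hg t (by simpa using ht.2)).continuousAt.continuousWithinAt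
  · exact hg t (by simpa using ht.1.2 : r < ‖t‖).le

theorem sub_ne_zero_of_mem_sphere (hz : ‖z‖ ≠ R) {t : ℂ} (ht : t ∈ Metric.sphere (0 : ℂ) R) :
    t - z ≠ 0 := by
  rintro h
  rw [sub_eq_zero.1 h, mem_sphere_zero_iff_norm] at ht
  exact hz ht

theorem circleIntegrable_div_sub (hf : ContinuousOn f (Metric.sphere 0 R)) (hR : 0 ≤ R)
    (hz : ‖z‖ ≠ R) : CircleIntegrable (fun t => f t / (t - z)) 0 R :=
  (hf.div (continuousOn_id.sub continuousOn_const)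
    fun _ ht => sub_ne_zero_of_mem_sphere hz ht).circleIntegrable hR

theorem cauchyTransform_eq_of_norm_lt (hf : DifferentiableOn ℂ f {0}ᶜ) (hz : ‖z‖ < r)
    (hrR : r ≤ R) : cauchyTransform R f z = cauchyTransform r f z := by
  have hr : 0 < r := (norm_nonneg z).trans_lt hz
  refine congrArg _ (circleIntegral_eq_of_differentiableAt hr hrR fun t ht => ?_)
  have ht0 : t ≠ 0 := norm_pos_iff.1 (hr.trans_le ht)
  have htz : t - z ≠ 0 := sub_ne_zero.2 fun h => by rw [h] at ht; exact hz.not_ge ht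
  exact (hf.differentiableAt (isOpen_compl_singleton.mem_nhds ht0)).div
    (differentiableAt_id.sub_const z) htz

theorem differentiableAt_cauchyTransform (hf : ContinuousOn f (Metric.sphere 0 R)) (hz : ‖z‖ < R) :
    DifferentiableAt ℂ (cauchyTransform R f) z := by
  have hR : 0 < R := (norm_nonneg z).trans_lt hz
  lift R to NNReal using hR.le
  have hseries := hasFPowerSeriesOn_cauchy_integral (hf.circleIntegrable hR.le)
    (by exact_mod_cast hR)
  simp only [smul_eq_mul, ← div_eq_inv_mul (f _)] at hseries
  exact hseries.differentiableOn.differentiableAt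
    (Metric.isOpen_eball.mem_nhds (by rw [Metric.eball_coe]; simpa using hz))

theorem cauchyTransform_one_of_norm_lt (hz : ‖z‖ < R) : cauchyTransform R (fun _ => 1) z = 1 := by
  simp only [cauchyTransform, one_div]
  rw [circleIntegral.integral_sub_inv_of_mem_ball (by simpa using hz),
    inv_mul_cancel₀ Complex.two_pi_I_ne_zero]

theorem cauchyTransform_one_of_lt_norm (hR : 0 ≤ R) (hz : R < ‖z‖) :
    cauchyTransform R (fun _ => 1) z = 0 := by
  have hdiff : ∀ t ∈ Metric.closedBall (0 : ℂ) R, DifferentiableAt ℂ (fun t => 1 / (t - z)) t := by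
    refine fun t ht => (differentiableAt_const 1).div (differentiableAt_id.sub_const z) ?_
    exact sub_ne_zero.2 fun h => hz.not_ge (by simpa [h] using ht)
  rw [cauchyTransform, Complex.circleIntegral_eq_zero_of_differentiable_on_off_countable hR
    Set.countable_empty (fun t ht => (hdiff t ht).continuousAt.continuousWithinAt)
    fun t ht => hdiff t (Metric.ball_subset_closedBall ht.1), mul_zero]

theorem cauchyTransform_sub_mul_cauchyTransform_one (hf : ContinuousOn f (Metric.sphere 0 R))
    (hR : 0 ≤ R) (hz : ‖z‖ ≠ R) :
    cauchyTransform R f z - f z * cauchyTransform R (fun _ => 1) z =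
      (2 * Real.pi * Complex.I)⁻¹ * ∮ t in C(0, R), dslope f z t := by
  have hslope : Set.EqOn (dslope f z) (fun t => f t / (t - z) - f z * (1 / (t - z)))
      (Metric.sphere 0 R) := fun t ht => by
    rw [dslope_of_ne f (sub_ne_zero.1 (sub_ne_zero_of_mem_sphere hz ht)), slope_def_field]
    ring
  have hconst : CircleIntegrable (fun t => f z * (1 / (t - z))) 0 R :=
    (circleIntegrable_div_sub continuousOn_const hR hz).const_fun_smul
  rw [circleIntegral.integral_congr hR hslope, circleIntegral.integral_sub
    (circleIntegrable_div_sub hf hR hz) hconst, circleIntegral.integral_const_mul]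
  simp only [cauchyTransform]
  ring

theorem sphere_subset_compl_singleton_zero (hR : 0 < R) : Metric.sphere (0 : ℂ) R ⊆ {0}ᶜ :=
  fun _ ht => ne_zero_of_mem_sphere hR.ne' ⟨_, ht⟩

theorem cauchyTransform_sub_cauchyTransform (hf : DifferentiableOn ℂ f {0}ᶜ) (hr : 0 < r)
    (hrz : r < ‖z‖) (hzR : ‖z‖ < R) : cauchyTransform R f z - cauchyTransform r f z = f z := by
  have hR : 0 < R := hr.trans (hrz.trans hzR)
  have hslope : DifferentiableOn ℂ (dslope f z) {0}ᶜ :=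
    (Complex.differentiableOn_dslope
      (isOpen_compl_singleton.mem_nhds (norm_pos_iff.1 (hr.trans hrz)))).2 hf
  have hindep : (∮ t in C(0, R), dslope f z t) = ∮ t in C(0, r), dslope f z t :=
    circleIntegral_eq_of_differentiableAt hr (hrz.trans hzR).le fun t ht =>
      hslope.differentiableAt
        (isOpen_compl_singleton.mem_nhds (norm_pos_iff.1 (hr.trans_le ht)))
  have houter := cauchyTransform_sub_mul_cauchyTransform_one
    (hf.continuousOn.mono (sphere_subset_compl_singleton_zero hR)) hR.le hzR.ne
  have hinner := cauchyTransform_sub_mul_cauchyTransform_one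
    (hf.continuousOn.mono (sphere_subset_compl_singleton_zero hr)) hr.le hrz.ne'
  rw [cauchyTransform_one_of_norm_lt hzR, hindep] at houter
  rw [cauchyTransform_one_of_lt_norm hr.le hrz] at hinner
  linear_combination houter - hinner

theorem tendsto_cauchyTransform_cobounded (hR : 0 ≤ R) (hf : ContinuousOn f (Metric.sphere 0 R)) :
    Tendsto (cauchyTransform R f) (Bornology.cobounded ℂ) (𝓝 0) := by
  obtain ⟨K, hK⟩ := (isCompact_sphere (0 : ℂ) R).exists_bound_of_continuousOn hf
  have hbound : ∀ᶠ z in Bornology.cobounded ℂ, ‖cauchyTransform R f z‖ ≤ R * (K / (‖z‖ - R)) := by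
    filter_upwards [tendsto_norm_cobounded_atTop.eventually_gt_atTop R]
      with z hz
    refine circleIntegral.norm_two_pi_i_inv_smul_integral_le_of_norm_le_const hR fun t ht => ?_
    have hdist : ‖z‖ - R ≤ ‖t - z‖ := by
      simpa [norm_sub_rev, mem_sphere_zero_iff_norm.1 ht] using norm_sub_norm_le z t
    rw [norm_div]
    exact div_le_div₀ ((norm_nonneg _).trans (hK t ht)) (hK t ht) (sub_pos.2 hz) hdist
  refine squeeze_zero_norm' hbound ?_
  rw [← mul_zero R]
  exact (tendsto_const_nhds.div_atTop
    (tendsto_atTop_add_const_right _ (-R) tendsto_norm_cobounded_atTop)).const_mul R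

theorem mul_cauchyTransform_div_id (hR : 0 < R) (hf : ContinuousOn f (Metric.sphere 0 R))
    (hz : ‖z‖ ≠ R) : z * cauchyTransform R (fun t => f t / t) z =
      cauchyTransform R f z - cauchyTransform R f 0 := by
  simp only [cauchyTransform]
  rw [mul_left_comm, ← circleIntegral.integral_const_mul, ← mul_sub, ← circleIntegral.integral_sub
    (circleIntegrable_div_sub hf hR.le hz)
    (circleIntegrable_div_sub hf hR.le (by simpa using hR.ne))]
  refine congrArg _ (circleIntegral.integral_congr hR.le fun t ht => ?_)
  have htz := sub_ne_zero_of_mem_sphere hz ht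
  have ht0 : t ≠ 0 := sphere_subset_compl_singleton_zero hR ht
  field_simp
  ring

theorem pow_mul_cauchyTransform_div_pow (hR : 0 < R) (hf : ContinuousOn f (Metric.sphere 0 R))
    (hz : ‖z‖ ≠ R) (n : ℕ) : z ^ n * cauchyTransform R (fun t => f t / t ^ n) z =
      cauchyTransform R f z -
        ∑ k ∈ Finset.range n, z ^ k * cauchyTransform R (fun t => f t / t ^ k) 0 := by
  induction n with
  | zero => simp
  | succ n ih =>
    have hcont : ContinuousOn (fun t => f t / t ^ n) (Metric.sphere 0 R) :=
      hf.div (continuousOn_pow n)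
        fun t ht => pow_ne_zero n (sphere_subset_compl_singleton_zero hR ht)
    have hstep := mul_cauchyTransform_div_id hR hcont hz
    simp only [div_div, ← pow_succ] at hstep
    rw [pow_succ, mul_assoc, hstep, mul_sub, ih, Finset.sum_range_succ]
    ring

/-- The entire function that agrees with the Cauchy transforms of `f` over all circles `|t| = R` at
the points `z` inside them; for `f` holomorphic off `0` the radius is irrelevant. -/
noncomputable def cauchyExtension (f : ℂ → ℂ) (z : ℂ) : ℂ :=
  cauchyTransform (‖z‖ + 1) f z

theorem cauchyExtension_of_norm_lt (hf : DifferentiableOn ℂ f {0}ᶜ) (hz : ‖z‖ < R) :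
    cauchyExtension f z = cauchyTransform R f z := by
  rcases le_total R (‖z‖ + 1) with h | h
  · exact cauchyTransform_eq_of_norm_lt hf hz h
  · exact (cauchyTransform_eq_of_norm_lt hf (lt_add_one _) h).symm

theorem differentiable_cauchyExtension (hf : DifferentiableOn ℂ f {0}ᶜ) :
    Differentiable ℂ (cauchyExtension f) := by
  intro z
  have hpos : 0 < ‖z‖ + 1 := by positivity
  refine (differentiableAt_cauchyTransform (hf.continuousOn.mono
    (sphere_subset_compl_singleton_zero hpos)) (lt_add_one _)).congr_of_eventuallyEq ?_
  filter_upwards [continuous_norm.continuousAt.eventually (gt_mem_nhds (lt_add_one ‖z‖))] with w hw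
  exact cauchyExtension_of_norm_lt hf hw

theorem cauchyExtension_of_lt_norm (hf : DifferentiableOn ℂ f {0}ᶜ) (hR : 0 < R) (hz : R < ‖z‖) :
    cauchyExtension f z = cauchyTransform R f z + f z :=
  eq_add_of_sub_eq' (cauchyTransform_sub_cauchyTransform hf hR hz (lt_add_one _))

end CauchyTransform

section Polynomials

theorem eval_eq_eval_reflect_inv {K : Type*} [Field K] {p : K[X]} {N : ℕ} (hp : p.natDegree ≤ N)
    {z : K} (hz : z ≠ 0) : p.eval z = (p.reflect N).eval z⁻¹ * z ^ N := by
  let _ := invertibleOfNonzero hz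
  exact invOf_eq_inv z ▸ (eval₂_reflect_mul_pow (RingHom.id K) z N p hp).symm

theorem tendsto_eval_div_pow_cobounded {𝕜 : Type*} [NormedField 𝕜] {p : 𝕜[X]} {N : ℕ}
    (hp : p.natDegree ≤ N) :
    Tendsto (fun z => p.eval z / z ^ N) (Bornology.cobounded 𝕜) (𝓝 (p.coeff N)) := by
  have hzero : (p.reflect N).eval 0 = p.coeff N := by
    rw [← coeff_zero_eq_eval_zero, coeff_reflect, revAt_zero]
  rw [← hzero]
  refine (((p.reflect N).continuous.tendsto 0).comp tendsto_inv₀_cobounded).congr' ?_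
  filter_upwards [Bornology.eventually_ne_cobounded (0 : 𝕜)] with z hz
  rw [Function.comp_apply, eval_eq_eval_reflect_inv hp hz,
    mul_div_cancel_right₀ _ (pow_ne_zero N hz)]

variable {ν : ℂ → ℂ} {p : ℂ[X]} {n : ℕ}

theorem eval_reflect_map_conj (hp : p.natDegree ≤ n) {z : ℂ} (hz : ‖z‖ = 1) :
    ((p.map (starRingEnd ℂ)).reflect n).eval z = z ^ n * (starRingEnd ℂ) (p.eval z) := by
  have hz0 : z ≠ 0 := norm_ne_zero_iff.1 (hz ▸ one_ne_zero)
  have hreflect := eval_eq_eval_reflect_inv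
    ((natDegree_map_le (f := starRingEnd ℂ)).trans hp) (inv_ne_zero hz0)
  rw [inv_inv, Complex.inv_eq_conj hz, eval_map, eval₂_hom] at hreflect
  rw [hreflect, ← Complex.inv_eq_conj hz, inv_pow, mul_comm,
    inv_mul_cancel_right₀ (pow_ne_zero n hz0)]

theorem pairing_reflect_map_conj_X_pow (hp : p.natDegree ≤ n) {j : ℕ} (hj : j ≤ n) :
    pairing ν ((p.map (starRingEnd ℂ)).reflect n) (X ^ j) = pairing ν (X ^ (n - j)) p := by
  rw [pairing_eq, pairing_eq]
  refine intervalIntegral.integral_congr fun θ _ => ?_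
  have hnorm : ‖circleMap 0 1 θ‖ = 1 := by simp
  have hne : circleMap 0 1 θ ≠ 0 := circleMap_ne_center one_ne_zero
  simp only [eval_reflect_map_conj hp hnorm, eval_pow, eval_X, map_pow,
    ← Complex.inv_eq_conj hnorm, inv_pow, pow_sub₀ _ hne hj]
  ring

theorem pairing_X_pow_eq (p : ℂ[X]) (k : ℕ) : pairing ν p (X ^ k) =
    2 * Real.pi * cauchyTransform 1 (fun t => p.eval t * ν t / t ^ k) 0 := by
  have hint : pairing ν p (X ^ k) =
      Complex.I⁻¹ * ∮ t in C(0, 1), p.eval t * ν t / t ^ k / (t - 0) := by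
    rw [pairing, ← circleIntegral.integral_const_mul]
    refine circleIntegral.integral_congr zero_le_one fun t ht => ?_
    have ht1 : ‖t‖ = 1 := mem_sphere_zero_iff_norm.1 ht
    simp only [eval_pow, eval_X, map_pow, ← Complex.inv_eq_conj ht1, inv_pow, sub_zero]
    ring
  have hpi : (Real.pi : ℂ) ≠ 0 := Complex.ofReal_ne_zero.2 Real.pi_ne_zero
  rw [hint, cauchyTransform]
  field_simp

theorem pairing_eq_sum_coeff (hν : IsPositiveWeight ν) {N : ℕ} (hp : p.natDegree < N) (q : ℂ[X]) :
    pairing ν p q = ∑ i ∈ Finset.range N, p.coeff i * pairing ν (X ^ i) q := by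
  conv_lhs => rw [p.as_sum_range_C_mul_X_pow' hp]
  rw [pairing_sum hν]
  exact Finset.sum_congr rfl fun i _ => pairing_C_mul ν _ _ _

end Polynomials

section Orthogonality

variable {ν : ℂ → ℂ} {p : ℂ[X]} {j n : ℕ}

theorem monicOP_coeff_self (ν : ℂ → ℂ) (n : ℕ) : (monicOP ν n).coeff n = 1 := by
  simpa only [monicOP_natDegree] using (monicOP_monic ν n).coeff_natDegree

theorem pairing_X_pow_monicOP (hν : IsPositiveWeight ν) (hj : j ≤ n) :
    pairing ν (X ^ j) (monicOP ν n) = if j = n then (((kappa ν n) ^ 2)⁻¹ : ℂ) else 0 := by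
  have horth := pairing_monicOP hν j n
  rw [monicOP_eq ν j, pairing_sub hν, pairing_sum hν, Finset.sum_eq_zero, sub_zero] at horth
  · rw [horth]
    split_ifs with h
    exacts [h ▸ rfl, rfl]
  · intro k _
    rw [pairing_C_mul, pairing_monicOP hν k n, if_neg (k.2.trans_le hj).ne, mul_zero]

theorem pairing_monicOP_X_pow (hν : IsPositiveWeight ν) (hj : j ≤ n) :
    pairing ν (monicOP ν n) (X ^ j) = if j = n then (((kappa ν n) ^ 2)⁻¹ : ℂ) else 0 := by
  rw [← pairing_conj hν, pairing_X_pow_monicOP hν hj]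
  split_ifs <;> simp

theorem pairing_monicOP_of_natDegree_lt (hν : IsPositiveWeight ν) (hp : p.natDegree < n) :
    pairing ν p (monicOP ν n) = 0 := by
  rw [pairing_eq_sum_coeff hν hp]
  refine Finset.sum_eq_zero fun i hi => ?_
  have hi := Finset.mem_range.1 hi
  rw [pairing_X_pow_monicOP hν hi.le, if_neg hi.ne, mul_zero]

theorem recipOP_natDegree_le (ν : ℂ → ℂ) (n : ℕ) : (recipOP ν n).natDegree ≤ n :=
  natDegree_reflect_le.trans (max_le le_rfl (natDegree_map_le.trans (monicOP_natDegree ν n).le))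

theorem recipOP_eval_zero (ν : ℂ → ℂ) (n : ℕ) : (recipOP ν n).eval 0 = 1 := by
  rw [← coeff_zero_eq_eval_zero, recipOP, coeff_reflect, revAt_zero, coeff_map, monicOP_coeff_self,
    map_one]

theorem pairing_recipOP_X_pow (hν : IsPositiveWeight ν) (hj : j ≤ n) :
    pairing ν (recipOP ν n) (X ^ j) = if j = 0 then (((kappa ν n) ^ 2)⁻¹ : ℂ) else 0 := by
  rw [recipOP, pairing_reflect_map_conj_X_pow (monicOP_natDegree ν n).le hj,
    pairing_X_pow_monicOP hν (Nat.sub_le n j)]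
  exact if_congr (by omega) rfl rfl

theorem pairing_recipOP_X_pow_succ (hν : IsPositiveWeight ν) (n : ℕ) :
    pairing ν (recipOP ν n) (X ^ (n + 1)) = verblunsky ν n * (((kappa ν n) ^ 2)⁻¹ : ℂ) := by
  have hlower : ∀ j ∈ Finset.range (n + 1), j ≠ 0 →
      (monicOP ν (n + 1)).coeff j * pairing ν (X ^ j) (recipOP ν n) = 0 := fun j hj hj0 => by
    rw [← pairing_conj hν, pairing_recipOP_X_pow hν (Nat.lt_succ_iff.1 (Finset.mem_range.1 hj)),
      if_neg hj0, map_zero, mul_zero]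
  have horth : pairing ν (monicOP ν (n + 1)) (recipOP ν n) = 0 := by
    rw [← pairing_conj hν, pairing_monicOP_of_natDegree_lt hν
      (Nat.lt_succ_of_le (recipOP_natDegree_le ν n)), map_zero]
  rw [pairing_eq_sum_coeff hν ((monicOP_natDegree ν (n + 1)).trans_lt (Nat.lt_succ_self _)),
    Finset.sum_range_succ, monicOP_coeff_self, Finset.sum_eq_single_of_mem 0 (by simp) hlower,
    ← pairing_conj hν (recipOP ν n), ← pairing_conj hν (recipOP ν n),
    pairing_recipOP_X_pow hν n.zero_le, if_pos rfl, coeff_zero_eq_eval_zero] at horth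
  have hconj := congrArg (starRingEnd ℂ) horth
  simp only [map_add, map_mul, map_one, map_zero, Complex.conj_conj] at hconj
  rw [verblunsky]
  linear_combination hconj

theorem b_pos (hν : IsPositiveWeight ν) (n : ℕ) : 0 < b ν n :=
  mul_pos Real.two_pi_pos (pow_pos (kappa_pos hν n) 2)

theorem kappa_sq_inv_eq (ν : ℂ → ℂ) (n : ℕ) :
    (((kappa ν n) ^ 2)⁻¹ : ℂ) = 2 * Real.pi * (b ν n : ℂ)⁻¹ := by
  have hpi : (Real.pi : ℂ) ≠ 0 := Complex.ofReal_ne_zero.2 Real.pi_ne_zero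
  rw [b]
  push_cast
  field_simp

end Orthogonality

section ConjugationSymmetry

variable {ν : ℂ → ℂ}

theorem pairing_map_conj (hν : IsPositiveWeight ν)
    (hsymm : ∀ z ∈ Metric.sphere (0 : ℂ) 1, ν ((starRingEnd ℂ) z) = ν z) (p q : ℂ[X]) :
    pairing ν (p.map (starRingEnd ℂ)) (q.map (starRingEnd ℂ)) =
      (starRingEnd ℂ) (pairing ν p q) := by
  have hreflect := intervalIntegral.integral_comp_sub_left (a := 0) (b := 2 * Real.pi)
    (fun θ : ℝ => (p.map (starRingEnd ℂ)).eval (circleMap 0 1 θ) *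
      (starRingEnd ℂ) ((q.map (starRingEnd ℂ)).eval (circleMap 0 1 θ)) * ν (circleMap 0 1 θ))
    (2 * Real.pi)
  rw [sub_self, sub_zero] at hreflect
  rw [pairing_eq, pairing_eq, ← intervalIntegral.intervalIntegral_conj, ← hreflect]
  refine intervalIntegral.integral_congr fun θ _ => ?_
  have hmem := circleMap_mem_sphere (0 : ℂ) zero_le_one θ
  have hconj : circleMap 0 1 (2 * Real.pi - θ) = (starRingEnd ℂ) (circleMap 0 1 θ) := by
    rw [(periodic_circleMap (0 : ℂ) 1).sub_eq']
    simp [circleMap, ← Complex.exp_conj]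
  have hreal : (starRingEnd ℂ) (ν (circleMap 0 1 θ)) = ν (circleMap 0 1 θ) :=
    Complex.conj_eq_iff_im.2 (hν.real _ hmem)
  simp only [hconj, eval_map, eval₂_hom, map_mul, hsymm _ hmem, hreal]

theorem monicOP_map_conj (hν : IsPositiveWeight ν)
    (hsymm : ∀ z ∈ Metric.sphere (0 : ℂ) 1, ν ((starRingEnd ℂ) z) = ν z) (n : ℕ) :
    (monicOP ν n).map (starRingEnd ℂ) = monicOP ν n := by
  induction n using Nat.strong_induction_on with
  | _ n ih =>
    rw [monicOP_eq, Polynomial.map_sub, Polynomial.map_pow, map_X, Polynomial.map_sum]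
    refine congrArg _ (Finset.sum_congr rfl fun k _ => ?_)
    have hnum := pairing_map_conj hν hsymm (X ^ n) (monicOP ν k)
    have hden := pairing_map_conj hν hsymm (monicOP ν k) (monicOP ν k)
    rw [Polynomial.map_pow, map_X, ih k k.2] at hnum
    rw [ih k k.2] at hden
    rw [Polynomial.map_mul, map_C, ih k k.2, map_div₀, ← hnum, ← hden]

theorem monicOP_eval_zero_eq_neg_verblunsky (hν : IsPositiveWeight ν)
    (hsymm : ∀ z ∈ Metric.sphere (0 : ℂ) 1, ν ((starRingEnd ℂ) z) = ν z) (n : ℕ) :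
    (monicOP ν (n + 1)).eval 0 = -verblunsky ν n := by
  have hreal := congrArg (eval 0) (monicOP_map_conj hν hsymm (n + 1))
  rw [← map_zero (starRingEnd ℂ), eval_map, eval₂_hom, map_zero] at hreal
  rw [verblunsky, hreal, neg_neg]

end ConjugationSymmetry

section AssociatedFunctions

variable {ν : ℂ → ℂ}

theorem assocG_eq_cauchyTransform (ν : ℂ → ℂ) (n : ℕ) :
    assocG ν n = cauchyTransform 1 fun t => (monicOP ν n).eval t * ν t / t ^ n := by
  ext z
  simp only [assocG, cauchyTransform, one_div, div_mul_div_comm, mul_comm _ (_ ^ n), div_div]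

theorem assocGStar_eq_cauchyTransform (ν : ℂ → ℂ) (n : ℕ) :
    assocGStar ν n = cauchyTransform 1 fun t => (recipOP ν n).eval t * ν t / t ^ (n + 1) := by
  ext z
  simp only [assocGStar, cauchyTransform, one_div, div_mul_div_comm, mul_comm _ (_ ^ (n + 1)),
    div_div]

theorem assocG_zero (hν : IsPositiveWeight ν) (n : ℕ) : assocG ν n 0 = (b ν n : ℂ)⁻¹ := by
  have hmoment := pairing_monicOP_X_pow hν (le_refl n)
  rw [if_pos rfl, kappa_sq_inv_eq, pairing_X_pow_eq, ← assocG_eq_cauchyTransform] at hmoment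
  exact mul_left_cancel₀ (by simp [Real.pi_ne_zero]) hmoment

theorem assocGStar_zero (hν : IsPositiveWeight ν) (n : ℕ) :
    assocGStar ν n 0 = verblunsky ν n * (b ν n : ℂ)⁻¹ := by
  have hmoment := pairing_recipOP_X_pow_succ hν n
  rw [kappa_sq_inv_eq, pairing_X_pow_eq, ← assocGStar_eq_cauchyTransform, mul_left_comm] at hmoment
  exact mul_left_cancel₀ (by simp [Real.pi_ne_zero]) hmoment

theorem tendsto_pow_mul_cauchyTransform (hν : IsPositiveWeight ν) (p : ℂ[X]) (n : ℕ) :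
    Tendsto (fun z => z ^ n * cauchyTransform 1 (fun t => p.eval t * ν t / t ^ n) z +
        (2 * Real.pi : ℂ)⁻¹ * ∑ k ∈ Finset.range n, z ^ k * pairing ν p (X ^ k))
      (Bornology.cobounded ℂ) (𝓝 0) := by
  have hcont : ContinuousOn (fun t => p.eval t * ν t) (Metric.sphere 0 1) :=
    p.continuous.continuousOn.mul hν.continuousOn
  refine (tendsto_cauchyTransform_cobounded zero_le_one hcont).congr' ?_
  filter_upwards [tendsto_norm_cobounded_atTop.eventually_gt_atTop 1] with z hz
  have hpi : (Real.pi : ℂ) ≠ 0 := Complex.ofReal_ne_zero.2 Real.pi_ne_zero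
  rw [pow_mul_cauchyTransform_div_pow one_pos hcont hz.ne', Finset.mul_sum, sub_add_eq_add_sub,
    eq_sub_iff_add_eq]
  refine congrArg _ (Finset.sum_congr rfl fun k _ => ?_)
  rw [pairing_X_pow_eq]
  field_simp

theorem tendsto_pow_mul_assocG (hν : IsPositiveWeight ν) (n : ℕ) :
    Tendsto (fun z => z ^ n * assocG ν n z) (Bornology.cobounded ℂ) (𝓝 0) := by
  have hmoments : ∀ z : ℂ, ∑ k ∈ Finset.range n, z ^ k * pairing ν (monicOP ν n) (X ^ k) = 0 :=
    fun z => Finset.sum_eq_zero fun k hk => by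
      have hk := Finset.mem_range.1 hk
      rw [pairing_monicOP_X_pow hν hk.le, if_neg hk.ne, mul_zero]
  simpa only [assocG_eq_cauchyTransform, hmoments, mul_zero, add_zero] using
    tendsto_pow_mul_cauchyTransform hν (monicOP ν n) n

theorem tendsto_pow_mul_assocGStar (hν : IsPositiveWeight ν) (n : ℕ) :
    Tendsto (fun z => z ^ (n + 1) * assocGStar ν n z) (Bornology.cobounded ℂ)
      (𝓝 (-(b ν n : ℂ)⁻¹)) := by
  have hmoments : ∀ z : ℂ, (2 * Real.pi : ℂ)⁻¹ *
      ∑ k ∈ Finset.range (n + 1), z ^ k * pairing ν (recipOP ν n) (X ^ k) = (b ν n : ℂ)⁻¹ := by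
    intro z
    rw [Finset.sum_eq_single_of_mem 0 (by simp) fun k hk hk0 => by
      rw [pairing_recipOP_X_pow hν (Nat.lt_succ_iff.1 (Finset.mem_range.1 hk)), if_neg hk0,
        mul_zero],
      pairing_recipOP_X_pow hν n.zero_le, if_pos rfl, kappa_sq_inv_eq, pow_zero, one_mul,
      inv_mul_cancel_left₀ (by simp [Real.pi_ne_zero])]
  have hlim := (tendsto_pow_mul_cauchyTransform hν (recipOP ν n) (n + 1)).sub_const (b ν n : ℂ)⁻¹
  simpa only [assocGStar_eq_cauchyTransform, hmoments, add_sub_cancel_right, zero_sub] using hlim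

end AssociatedFunctions

section EntireContinuation

variable {ν : ℂ → ℂ} {n : ℕ} {z : ℂ}

theorem differentiableOn_eval_mul_div_pow (hν : DifferentiableOn ℂ ν {0}ᶜ) (p : ℂ[X]) (n : ℕ) :
    DifferentiableOn ℂ (fun t => p.eval t * ν t / t ^ n) {0}ᶜ :=
  (p.differentiable.differentiableOn.mul hν).div (differentiableOn_pow n)
    fun _ ht => pow_ne_zero n ht

/-- The entire continuation of `Y_n` from the unit disc, for a weight holomorphic off `0`. -/
noncomputable def entireY (ν : ℂ → ℂ) (n : ℕ) (z : ℂ) : Matrix (Fin 2) (Fin 2) ℂ :=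
  !![(monicOP ν n).eval z, cauchyExtension (fun t => (monicOP ν n).eval t * ν t / t ^ n) z;
     -(b ν (n - 1) : ℂ) * (recipOP ν (n - 1)).eval z,
     -(b ν (n - 1) : ℂ) *
       cauchyExtension (fun t => (recipOP ν (n - 1)).eval t * ν t / t ^ n) z]

theorem differentiable_entireY_apply (hν : DifferentiableOn ℂ ν {0}ᶜ) (n : ℕ) (i j : Fin 2) :
    Differentiable ℂ fun z => entireY ν n z i j := by
  have hG := differentiable_cauchyExtension (differentiableOn_eval_mul_div_pow hν (monicOP ν n) n)
  have hGStar := differentiable_cauchyExtension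
    (differentiableOn_eval_mul_div_pow hν (recipOP ν (n - 1)) n)
  fin_cases i <;> fin_cases j
  exacts [(monicOP ν n).differentiable, hG, (recipOP ν (n - 1)).differentiable.const_mul _,
    hGStar.const_mul _]

theorem Y_eq_entireY_of_norm_lt_one (hν : DifferentiableOn ℂ ν {0}ᶜ) (n : ℕ) (hz : ‖z‖ < 1) :
    Y ν (n + 1) z = entireY ν (n + 1) z := by
  simp only [Y, entireY, assocG_eq_cauchyTransform, assocGStar_eq_cauchyTransform,
    Nat.add_sub_cancel, cauchyExtension_of_norm_lt (differentiableOn_eval_mul_div_pow hν _ _) hz]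

theorem Y_eq_entireY_mul_of_one_lt_norm (hν : DifferentiableOn ℂ ν {0}ᶜ) (n : ℕ) (hz : 1 < ‖z‖) :
    Y ν (n + 1) z = entireY ν (n + 1) z * !![1, -(ν z / z ^ (n + 1)); 0, 1] := by
  simp only [Y, entireY, assocG_eq_cauchyTransform, assocGStar_eq_cauchyTransform,
    Nat.add_sub_cancel, Matrix.mul_fin_two,
    cauchyExtension_of_lt_norm (differentiableOn_eval_mul_div_pow hν _ _) one_pos hz]
  congr! 3 <;> ring_nf

theorem tendsto_det_Y (hν : IsPositiveWeight ν) (n : ℕ) :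
    Tendsto (fun z => (Y ν (n + 1) z).det) (Bornology.cobounded ℂ) (𝓝 1) := by
  have hb : (b ν n : ℂ) ≠ 0 := Complex.ofReal_ne_zero.2 (b_pos hν n).ne'
  have hΦ := tendsto_eval_div_pow_cobounded (monicOP_natDegree ν (n + 1)).le
  have hΦStar := tendsto_eval_div_pow_cobounded ((recipOP_natDegree_le ν n).trans n.le_succ)
  have hlim := ((hΦ.mul (tendsto_pow_mul_assocGStar hν n)).sub
    ((tendsto_pow_mul_assocG hν (n + 1)).mul hΦStar)).const_mul (-(b ν n : ℂ))
  rw [monicOP_coeff_self, one_mul, zero_mul, sub_zero, neg_mul_neg, mul_inv_cancel₀ hb] at hlim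
  refine hlim.congr' ?_
  filter_upwards [Bornology.eventually_ne_cobounded (0 : ℂ)] with z hz
  rw [Y, Matrix.det_fin_two_of, Nat.add_sub_cancel]
  field_simp
  ring

theorem det_entireY (hν : IsPositiveWeight ν) (hdiff : DifferentiableOn ℂ ν {0}ᶜ) (n : ℕ) (z : ℂ) :
    (entireY ν (n + 1) z).det = 1 := by
  have hentire : Differentiable ℂ fun z => (entireY ν (n + 1) z).det := by
    have hentry := differentiable_entireY_apply hdiff (n + 1)
    simp only [Matrix.det_fin_two]
    exact ((hentry 0 0).mul (hentry 1 1)).sub ((hentry 0 1).mul (hentry 1 0))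
  refine hentire.apply_eq_of_tendsto_cocompact z ?_
  rw [← Metric.cobounded_eq_cocompact]
  refine (tendsto_det_Y hν n).congr' ?_
  filter_upwards [tendsto_norm_cobounded_atTop.eventually_gt_atTop 1] with w hw
  simp [Y_eq_entireY_mul_of_one_lt_norm hdiff n hw]

theorem differentiable_entireY_inv_apply (hν : IsPositiveWeight ν)
    (hdiff : DifferentiableOn ℂ ν {0}ᶜ) (n : ℕ) (i j : Fin 2) :
    Differentiable ℂ fun z => (entireY ν (n + 1) z)⁻¹ i j := by
  have hentry := differentiable_entireY_apply hdiff (n + 1)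
  simp only [Matrix.inv_def, det_entireY hν hdiff, Ring.inverse_one, one_smul,
    Matrix.adjugate_fin_two]
  fin_cases i <;> fin_cases j
  exacts [hentry 1 1, (hentry 0 1).neg, (hentry 1 0).neg, hentry 0 0]

theorem entireY_zero (hν : IsPositiveWeight ν) (hdiff : DifferentiableOn ℂ ν {0}ᶜ)
    (hsymm : ∀ z ∈ Metric.sphere (0 : ℂ) 1, ν ((starRingEnd ℂ) z) = ν z) (n : ℕ) :
    entireY ν (n + 1) 0 =
      !![-verblunsky ν n, (b ν (n + 1) : ℂ)⁻¹; -(b ν n : ℂ), -verblunsky ν n] := by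
  have hb : (b ν n : ℂ) ≠ 0 := Complex.ofReal_ne_zero.2 (b_pos hν n).ne'
  rw [← Y_eq_entireY_of_norm_lt_one hdiff n (by simp), Y, Nat.add_sub_cancel, assocG_zero hν,
    assocGStar_zero hν, recipOP_eval_zero, monicOP_eval_zero_eq_neg_verblunsky hν hsymm]
  field_simp

end EntireContinuation

section MatrixLogDeriv

open scoped Matrix.Norms.Operator

/-- The third Pauli matrix `σ₃`, the generator of the one-parameter group `diag(u, u⁻¹)`. -/
def pauliZ : Matrix (Fin 2) (Fin 2) ℂ := !![1, 0; 0, -1]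

variable {X Z : ℂ → Matrix (Fin 2) (Fin 2) ℂ} {X' K : Matrix (Fin 2) (Fin 2) ℂ} {u : ℂ → ℂ}
  {q z : ℂ}

theorem hasDerivAt_matrix :
    HasDerivAt Z X' z ↔ ∀ i j, HasDerivAt (fun w => Z w i j) (X' i j) z :=
  (hasDerivAt_pi (𝕜 := ℂ) (E' := fun _ => Fin 2 → ℂ) (φ := Z) (φ' := X')).trans
    (forall_congr' fun _ => hasDerivAt_pi)

theorem matDeriv_eq_of_hasDerivAt (h : HasDerivAt Z X' z) : matDeriv Z z = X' := by
  ext i j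
  exact (hasDerivAt_matrix.1 h i j).deriv

theorem hasDerivAt_matDeriv (h : ∀ i j, DifferentiableAt ℂ (fun w => Z w i j) z) :
    HasDerivAt Z (matDeriv Z z) z :=
  hasDerivAt_matrix.2 fun i j => (h i j).hasDerivAt

theorem hasDerivAt_diag_inv (hu : HasDerivAt u (u z * q) z) (hu0 : u z ≠ 0) :
    HasDerivAt (fun w => !![u w, 0; 0, (u w)⁻¹]) (q • (pauliZ * !![u z, 0; 0, (u z)⁻¹])) z := by
  refine hasDerivAt_matrix.2 fun i j => ?_
  fin_cases i <;> fin_cases j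
  · simpa [pauliZ, mul_comm] using hu
  · simpa [pauliZ] using hasDerivAt_const z (0 : ℂ)
  · simpa [pauliZ] using hasDerivAt_const z (0 : ℂ)
  · refine (hu.inv hu0).congr_deriv ?_
    simp [pauliZ]
    field_simp

theorem matDeriv_mul_inv_of_eventuallyEq (hX : ∀ i j, DifferentiableAt ℂ (fun w => X w i j) z)
    (hu : HasDerivAt u (u z * q) z) (hu0 : u z ≠ 0) (hK : IsUnit K.det)
    (hZ : Z =ᶠ[𝓝 z] fun w => X w * !![u w, 0; 0, (u w)⁻¹] * K) :
    matDeriv Z z * (Z z)⁻¹ = (matDeriv X z + q • (X z * pauliZ)) * (X z)⁻¹ := by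
  set D : ℂ → Matrix (Fin 2) (Fin 2) ℂ := fun w => !![u w, 0; 0, (u w)⁻¹] with hDdef
  have hD : IsUnit (D z).det := by simp [hDdef, Matrix.det_fin_two_of, hu0]
  have hfactor : matDeriv X z * D z + X z * (q • (pauliZ * D z)) =
      (matDeriv X z + q • (X z * pauliZ)) * D z := by
    rw [add_mul, mul_smul_comm, smul_mul_assoc, mul_assoc]
  have hderiv : matDeriv Z z = (matDeriv X z + q • (X z * pauliZ)) * D z * K := by
    rw [← hfactor]
    exact matDeriv_eq_of_hasDerivAt ((((hasDerivAt_matDeriv hX).mul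
      (hasDerivAt_diag_inv hu hu0)).mul_const K).congr_of_eventuallyEq hZ)
  rw [hderiv, hZ.self_of_nhds, Matrix.mul_inv_rev, Matrix.mul_inv_rev, ← mul_assoc,
    Matrix.mul_nonsing_inv_cancel_right _ _ hK, ← mul_assoc,
    Matrix.mul_nonsing_inv_cancel_right _ _ hD]

end MatrixLogDeriv

section StructureMatrix

variable {ν : ℂ → ℂ} {n : ℕ} {U : Set ℂ} {z : ℂ} {Z : ℂ → Matrix (Fin 2) (Fin 2) ℂ}

/-- The common value of `Z_n' Z_n⁻¹` for all branches of `Z_n`, when the weight is holomorphic and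
zero-free off `0`. It is the logarithmic derivative of `entireY ν n * diag(u, u⁻¹)` with
`u² = ν / zⁿ`, hence `u' / u = (ν' / ν - n / z) / 2`. -/
noncomputable def structureMatrix (ν : ℂ → ℂ) (n : ℕ) (z : ℂ) : Matrix (Fin 2) (Fin 2) ℂ :=
  (matDeriv (entireY ν n) z + ((logDeriv ν z - n / z) / 2) • (entireY ν n z * pauliZ)) *
    (entireY ν n z)⁻¹

theorem hasDerivAt_of_sq_eventuallyEq {f u : ℂ → ℂ} (hu : DifferentiableAt ℂ u z)
    (huf : (fun w => u w ^ 2) =ᶠ[𝓝 z] f) (hu0 : u z ≠ 0) :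
    HasDerivAt u (u z * (logDeriv f z / 2)) z := by
  have hlog : 2 * logDeriv u z = logDeriv f z := by
    rw [← (logDeriv_congr_nhds huf).eq_of_nhds, logDeriv_fun_pow hu]
    norm_num
  rw [← hlog, mul_div_cancel_left₀ _ two_ne_zero, logDeriv_apply, mul_div_cancel₀ _ hu0]
  exact hu.hasDerivAt

theorem logDeriv_div_pow {f : ℂ → ℂ} (hf : DifferentiableAt ℂ f z) (hfz : f z ≠ 0) (hz : z ≠ 0)
    (n : ℕ) : logDeriv (fun w => f w / w ^ n) z = logDeriv f z - n / z := by
  rw [logDeriv_div (g := fun w => w ^ n) z hfz (pow_ne_zero n hz) hf (differentiableAt_pow n),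
    logDeriv_pow]

theorem IsFundamentalBranch.exists_sqrt (hZ : IsFundamentalBranch ν n U Z) :
    ∃ u : ℂ → ℂ, DifferentiableOn ℂ u U ∧ (∀ w ∈ U, u w ^ 2 = ν w / w ^ n) ∧
      ∀ w ∈ U, Z w = Y ν n w * !![u w, 0; 0, (u w)⁻¹] := by
  obtain ⟨-, hU, s, r, hs, hr, hs2, hr2, hZ⟩ := hZ
  have hs0 : ∀ w ∈ U, s w ^ n ≠ 0 := fun w hw =>
    pow_ne_zero n fun h => (hU w hw).2 (by simpa [h] using (hs2 w hw).symm)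
  refine ⟨fun w => (s w ^ n)⁻¹ * r w, ((hs.pow n).inv hs0).mul hr, fun w hw => ?_, fun w hw => ?_⟩
  · rw [mul_pow, inv_pow, pow_right_comm, hs2 w hw, hr2 w hw, div_eq_inv_mul]
  · rw [hZ w hw, mul_inv, inv_inv]

theorem exists_isFundamentalBranch (hν : DifferentiableOn ℂ ν {0}ᶜ) (n : ℕ) (hνz : ν z ≠ 0)
    (hz1 : ‖z‖ ≠ 1) (hz : z ≠ 0) : ∃ U Z, z ∈ U ∧ IsFundamentalBranch ν n U Z := by
  have hopen : IsOpen ({w : ℂ | ‖w‖ ≠ 1} ∩ {0}ᶜ) :=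
    (isOpen_ne.preimage continuous_norm).inter isOpen_compl_singleton
  obtain ⟨V, hVsub, hV, hzV, r, hr, hr2⟩ :=
    exists_isOpen_sq_eq hopen (hν.mono Set.inter_subset_right) ⟨hz1, hz⟩ hνz
  obtain ⟨W, hWV, hW, hzW, s, hs, hs2⟩ := exists_isOpen_sq_eq hV differentiableOn_id hzV hz
  exact ⟨W, _, hzW, hW, fun w hw => hVsub (hWV hw), s, r, hs, hr.mono hWV, hs2,
    fun w hw => hr2 w (hWV hw), fun w _ => rfl⟩

theorem Y_mul_diag_inv_of_one_lt_norm (hν : DifferentiableOn ℂ ν {0}ᶜ) (hz : 1 < ‖z‖) {u : ℂ}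
    (hu : u ^ 2 = ν z / z ^ (n + 1)) (hu0 : u ≠ 0) :
    Y ν (n + 1) z * !![u, 0; 0, u⁻¹] =
      entireY ν (n + 1) z * !![u, 0; 0, u⁻¹] * !![1, -1; 0, 1] := by
  have hjump : !![1, -(u ^ 2); 0, 1] * !![u, 0; 0, u⁻¹] =
      !![u, 0; 0, u⁻¹] * (!![1, -1; 0, 1] : Matrix (Fin 2) (Fin 2) ℂ) := by
    have hsq : u ^ 2 * u⁻¹ = u := by field_simp
    simp [hsq]
  rw [Y_eq_entireY_mul_of_one_lt_norm hν n hz, ← hu, mul_assoc, hjump, mul_assoc]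

theorem eventually_Y_mul_diag_inv (hν : DifferentiableOn ℂ ν {0}ᶜ) (n : ℕ) (hz : ‖z‖ ≠ 1) :
    ∃ K : Matrix (Fin 2) (Fin 2) ℂ, IsUnit K.det ∧ ∀ᶠ w in 𝓝 z, ∀ u : ℂ, u ≠ 0 →
      u ^ 2 = ν w / w ^ (n + 1) → Y ν (n + 1) w * !![u, 0; 0, u⁻¹] =
        entireY ν (n + 1) w * !![u, 0; 0, u⁻¹] * K := by
  rcases lt_or_gt_of_ne hz with hlt | hgt
  · refine ⟨1, by simp, ?_⟩
    filter_upwards [continuous_norm.continuousAt.eventually (gt_mem_nhds hlt)] with w hw u _ _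
    rw [Y_eq_entireY_of_norm_lt_one hν n hw, mul_one]
  · refine ⟨!![1, -1; 0, 1], by simp, ?_⟩
    filter_upwards [continuous_norm.continuousAt.eventually (lt_mem_nhds hgt)] with w hw u hu0 hu
    exact Y_mul_diag_inv_of_one_lt_norm hν hw hu hu0

theorem isStructureMatrix_structureMatrix (hν : DifferentiableOn ℂ ν {0}ᶜ)
    (hν0 : ∀ z, z ≠ 0 → ν z ≠ 0) (n : ℕ) :
    IsStructureMatrix ν (n + 1) (structureMatrix ν (n + 1)) := by
  refine fun z hz1 hz => ⟨exists_isFundamentalBranch hν _ (hν0 z hz) hz1 hz, fun U Z hzU hZ => ?_⟩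
  obtain ⟨u, hu, hu2, hZu⟩ := hZ.exists_sqrt
  obtain ⟨K, hK, hYK⟩ := eventually_Y_mul_diag_inv hν n hz1
  have hUz : U ∈ 𝓝 z := hZ.1.mem_nhds hzU
  have hu0 : ∀ w ∈ U, u w ≠ 0 := fun w hw h => by
    have hw0 := (hZ.2.1 w hw).2
    refine div_ne_zero (hν0 w hw0) (pow_ne_zero (n + 1) hw0) ?_
    rw [← hu2 w hw, h, zero_pow two_ne_zero]
  have hZK : Z =ᶠ[𝓝 z] fun w => entireY ν (n + 1) w * !![u w, 0; 0, (u w)⁻¹] * K := by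
    filter_upwards [hUz, hYK] with w hw hwK
    rw [hZu w hw, hwK _ (hu0 w hw) (hu2 w hw)]
  have hderiv : HasDerivAt u (u z * ((logDeriv ν z - (n + 1 : ℕ) / z) / 2)) z := by
    rw [← logDeriv_div_pow (hν.differentiableAt (isOpen_compl_singleton.mem_nhds hz)) (hν0 z hz) hz]
    exact hasDerivAt_of_sq_eventuallyEq (hu.differentiableAt hUz)
      (Filter.eventuallyEq_of_mem hUz hu2) (hu0 z hzU)
  exact (matDeriv_mul_inv_of_eventuallyEq
    (fun i j => differentiable_entireY_apply hν (n + 1) i j z) hderiv (hu0 z hzU) hK hZK).symm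

end StructureMatrix

section Poles

variable {f g : ℂ → ℂ} {M E : ℂ → Matrix (Fin 2) (Fin 2) ℂ} {k : ℕ} {z₀ : ℂ}

theorem eventuallyEq_zpow_mul (hf : ∀ᶠ z in 𝓝[≠] z₀, (z - z₀) ^ k * f z = g z) :
    f =ᶠ[𝓝[≠] z₀] (fun z => (z - z₀) ^ (-(k : ℤ))) * g := by
  filter_upwards [hf, self_mem_nhdsWithin] with z hz hne
  rw [Pi.mul_apply, ← hz, zpow_neg, zpow_natCast,
    inv_mul_cancel_left₀ (pow_ne_zero k (sub_ne_zero.2 hne))]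

theorem meromorphicAt_of_pow_mul_eq (hg : MeromorphicAt g z₀)
    (hf : ∀ᶠ z in 𝓝[≠] z₀, (z - z₀) ^ k * f z = g z) : MeromorphicAt f z₀ := by
  have hpow : MeromorphicAt (fun z : ℂ => (z - z₀) ^ (-(k : ℤ))) z₀ := by fun_prop
  exact (hpow.mul hg).congr (eventuallyEq_zpow_mul hf).symm

theorem meromorphicOrderAt_of_pow_mul_eq (hg : MeromorphicAt g z₀)
    (hf : ∀ᶠ z in 𝓝[≠] z₀, (z - z₀) ^ k * f z = g z) :
    meromorphicOrderAt f z₀ = ((-(k : ℤ) : ℤ) : WithTop ℤ) + meromorphicOrderAt g z₀ := by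
  have hpow : MeromorphicAt (fun z : ℂ => (z - z₀) ^ (-(k : ℤ))) z₀ := by fun_prop
  rw [meromorphicOrderAt_congr (eventuallyEq_zpow_mul hf), meromorphicOrderAt_mul hpow hg,
    fun_meromorphicOrderAt_zpow_id_sub_const]

theorem hasPoleOfOrder_of_pow_smul_eq (hk : 0 < k) (hE : ∀ i j, AnalyticAt ℂ (fun z => E z i j) z₀)
    (hE0 : E z₀ ≠ 0) (hM : ∀ᶠ z in 𝓝[≠] z₀, (z - z₀) ^ k • M z = E z) :
    HasPoleOfOrder M k z₀ := by
  have hentry : ∀ i j, ∀ᶠ z in 𝓝[≠] z₀, (z - z₀) ^ k * M z i j = E z i j := fun i j =>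
    hM.mono fun z hz => congrFun₂ hz i j
  have horder := fun i j => meromorphicOrderAt_of_pow_mul_eq (hE i j).meromorphicAt (hentry i j)
  refine ⟨hk, fun i j => ⟨meromorphicAt_of_pow_mul_eq (hE i j).meromorphicAt (hentry i j), ?_⟩, ?_⟩
  · rw [horder]
    exact le_add_of_nonneg_right (hE i j).meromorphicOrderAt_nonneg
  · obtain ⟨i, j, hij⟩ : ∃ i j, E z₀ i j ≠ 0 := by
      by_contra! h
      exact hE0 (Matrix.ext h)
    refine ⟨i, j, ?_⟩
    rw [horder, (hE i j).meromorphicOrderAt_eq, (hE i j).analyticOrderAt_eq_zero.2 hij]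
    simp

theorem differentiableOn_of_pow_smul_eq (hE : ∀ i j, Differentiable ℂ fun z => E z i j)
    (hM : ∀ z, z ≠ z₀ → (z - z₀) ^ k • M z = E z) (i j : Fin 2) :
    DifferentiableOn ℂ (fun z => M z i j) {z₀}ᶜ := by
  have hpow : ∀ z ∈ ({z₀}ᶜ : Set ℂ), (z - z₀) ^ k ≠ 0 := fun z hz =>
    pow_ne_zero k (sub_ne_zero.2 hz)
  have hquot : ∀ z ∈ ({z₀}ᶜ : Set ℂ), M z i j = E z i j / (z - z₀) ^ k := fun z hz => by
    rw [← hM z hz, Matrix.smul_apply, smul_eq_mul, mul_div_cancel_left₀ _ (hpow z hz)]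
  exact ((hE i j).differentiableOn.fun_div (by fun_prop) hpow).congr hquot

theorem tendsto_pow_smul_of_eq (hE : ∀ i j, Differentiable ℂ fun z => E z i j)
    (hM : ∀ z, z ≠ z₀ → (z - z₀) ^ k • M z = E z) :
    Tendsto (fun z => (z - z₀) ^ k • M z) (𝓝[≠] z₀) (𝓝 (E z₀)) := by
  have hcont : Continuous E := continuous_matrix fun i j => (hE i j).continuous
  exact ((hcont.tendsto z₀).mono_left nhdsWithin_le_nhds).congr'
    (eventually_mem_nhdsWithin.mono fun z hz => (hM z hz).symm)

end Poles

section BesselWeight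

variable {l : ℝ} {ν H : ℂ → ℂ} {c z : ℂ}

theorem besselWeight_im_eq_zero_iff (hz : z ∈ Metric.sphere (0 : ℂ) 1) :
    (besselWeight l H z).im = 0 ↔ (H z).im = 0 := by
  have harg : (l * (z + z⁻¹) / 2 : ℂ) = ((l * z.re : ℝ) : ℂ) := by
    rw [Complex.inv_eq_conj (mem_sphere_zero_iff_norm.1 hz), Complex.add_conj]
    push_cast
    ring
  rw [besselWeight, harg, ← Complex.ofReal_exp, Complex.im_ofReal_mul,
    mul_eq_zero_iff_left (Real.exp_ne_zero _)]

theorem exists_eq_const_of_isPositiveWeight (hH : Differentiable ℂ H)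
    (hν : IsPositiveWeight (besselWeight l H)) : ∃ c, c ≠ 0 ∧ H = fun _ => c := by
  obtain ⟨c, rfl⟩ := eq_const_of_im_eq_zero_on_frontier hH Metric.isBounded_ball Metric.isOpen_ball
    (Metric.nonempty_ball.2 one_pos) fun z hz =>
      (besselWeight_im_eq_zero_iff (by rwa [frontier_ball 0 one_ne_zero] at hz)).1
        (hν.real z (by rwa [frontier_ball 0 one_ne_zero] at hz))
  refine ⟨c, ?_, rfl⟩
  rintro rfl
  obtain ⟨z, -, hz⟩ := hν.nontrivial
  exact hz (by simp [besselWeight])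

theorem besselWeight_const_conj (hz : z ∈ Metric.sphere (0 : ℂ) 1) :
    besselWeight l (fun _ => c) ((starRingEnd ℂ) z) = besselWeight l (fun _ => c) z := by
  rw [besselWeight, besselWeight, ← Complex.inv_eq_conj (mem_sphere_zero_iff_norm.1 hz), inv_inv,
    add_comm]

theorem besselWeight_const_ne_zero (hc : c ≠ 0) (z : ℂ) : besselWeight l (fun _ => c) z ≠ 0 :=
  mul_ne_zero (Complex.exp_ne_zero _) hc

theorem hasDerivAt_besselWeight_const (hz : z ≠ 0) :
    HasDerivAt (besselWeight l fun _ => c)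
      (l / 2 * (1 - (z ^ 2)⁻¹) * besselWeight l (fun _ => c) z) z := by
  have hexp := ((((hasDerivAt_id z).add (hasDerivAt_inv hz)).const_mul (l : ℂ)).div_const 2).cexp
  refine (hexp.mul_const c).congr_deriv ?_
  simp only [besselWeight, Pi.add_apply, id]
  ring

theorem differentiableOn_besselWeight_const :
    DifferentiableOn ℂ (besselWeight l fun _ => c) {0}ᶜ := fun _ hz =>
  (hasDerivAt_besselWeight_const hz).differentiableAt.differentiableWithinAt

theorem logDeriv_besselWeight_const (hc : c ≠ 0) (hz : z ≠ 0) :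
    logDeriv (besselWeight l fun _ => c) z = l / 2 * (1 - (z ^ 2)⁻¹) := by
  rw [logDeriv_apply, (hasDerivAt_besselWeight_const hz).deriv,
    mul_div_cancel_right₀ _ (besselWeight_const_ne_zero hc z)]

/-- The function `z² M_n(z)` for the weight `c * exp (l (z + z⁻¹) / 2)`, with the factor `z²`
multiplied out so that it is the holomorphic continuation, and not a junk value, at `z = 0`. -/
noncomputable def besselNumerator (l : ℝ) (ν : ℂ → ℂ) (n : ℕ) (z : ℂ) : Matrix (Fin 2) (Fin 2) ℂ :=
  (z ^ 2 • matDeriv (entireY ν n) z +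
    (l / 4 * (z ^ 2 - 1) - n * z / 2) • (entireY ν n z * pauliZ)) * (entireY ν n z)⁻¹

theorem sq_smul_structureMatrix_besselWeight (hc : c ≠ 0) (n : ℕ) (hz : z ≠ 0) :
    z ^ 2 • structureMatrix (besselWeight l fun _ => c) n z =
      besselNumerator l (besselWeight l fun _ => c) n z := by
  have hcoeff : z ^ 2 * ((l / 2 * (1 - (z ^ 2)⁻¹) - n / z) / 2) =
      l / 4 * (z ^ 2 - 1) - n * z / 2 := by
    field_simp
    ring
  rw [structureMatrix, besselNumerator, logDeriv_besselWeight_const hc hz, ← smul_mul_assoc,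
    smul_add, smul_smul, hcoeff]

theorem differentiable_besselNumerator_apply (hν : IsPositiveWeight ν)
    (hdiff : DifferentiableOn ℂ ν {0}ᶜ) (l : ℝ) (n : ℕ) (i j : Fin 2) :
    Differentiable ℂ fun z => besselNumerator l ν (n + 1) z i j := by
  have hentry := differentiable_entireY_apply hdiff (n + 1)
  have hinv := differentiable_entireY_inv_apply hν hdiff n
  simp only [besselNumerator, Matrix.mul_apply, Matrix.add_apply, Matrix.smul_apply, smul_eq_mul]
  exact Differentiable.fun_sum fun k _ => (((differentiable_fun_id.pow 2).mul
    (hentry i k).deriv).add ((by fun_prop : Differentiable ℂ _).mul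
      (Differentiable.fun_sum fun m _ => (hentry i m).mul_const _))).mul (hinv k j)

theorem besselNumerator_zero (hν : IsPositiveWeight ν) (hdiff : DifferentiableOn ℂ ν {0}ᶜ)
    (hsymm : ∀ z ∈ Metric.sphere (0 : ℂ) 1, ν ((starRingEnd ℂ) z) = ν z) (l : ℝ) (n : ℕ) :
    besselNumerator l ν (n + 1) 0 = besselLeadingCoeff l ν (n + 1) := by
  rw [besselNumerator, besselLeadingCoeff, Matrix.inv_def, det_entireY hν hdiff, Ring.inverse_one,
    one_smul, entireY_zero hν hdiff hsymm, Matrix.adjugate_fin_two_of, pauliZ, Nat.add_sub_cancel]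
  ext i j
  fin_cases i <;> fin_cases j <;> simp <;> ring

theorem besselLeadingCoeff_ne_zero (hl : l ≠ 0) (hν : IsPositiveWeight ν) (n : ℕ) :
    besselLeadingCoeff l ν n ≠ 0 := by
  intro h
  have hl' : (l : ℂ) ≠ 0 := Complex.ofReal_ne_zero.2 hl
  have hb : ∀ k, (b ν k : ℂ) ≠ 0 := fun k => Complex.ofReal_ne_zero.2 (b_pos hν k).ne'
  have hα : verblunsky ν (n - 1) = 0 := by
    simpa [besselLeadingCoeff, hl', hb] using congrFun₂ h 1 0
  simpa [besselLeadingCoeff, hα, hl', hb] using congrFun₂ h 0 0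

end BesselWeight

end OPUC

open OPUC in
theorem mainTheorem7_general (l : ℝ) (hl : l ≠ 0) (H : ℂ → ℂ) (hH : Differentiable ℂ H)
    (hν : IsPositiveWeight (besselWeight l H)) (n : ℕ) (hn : 1 ≤ n) :
    ∃ M : ℂ → Matrix (Fin 2) (Fin 2) ℂ,
      IsStructureMatrix (besselWeight l H) n M ∧
      (∀ i j, DifferentiableOn ℂ (fun z => M z i j) {0}ᶜ) ∧
      HasPoleOfOrder M 2 0 ∧
      besselLeadingCoeff l (besselWeight l H) n ≠ 0 ∧
      Tendsto (fun z : ℂ => z ^ 2 • M z) (𝓝[≠] 0)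
        (𝓝 (besselLeadingCoeff l (besselWeight l H) n)) := by
  obtain ⟨m, rfl⟩ := Nat.exists_eq_add_of_le' hn
  obtain ⟨c, hc, rfl⟩ := exists_eq_const_of_isPositiveWeight hH hν
  set ν := besselWeight l fun _ => c
  have hdiff : DifferentiableOn ℂ ν {0}ᶜ := differentiableOn_besselWeight_const
  have hentire := differentiable_besselNumerator_apply hν hdiff l m
  have hzero : besselNumerator l ν (m + 1) 0 = besselLeadingCoeff l ν (m + 1) :=
    besselNumerator_zero hν hdiff (fun _ => besselWeight_const_conj) l m
  have hlead := besselLeadingCoeff_ne_zero hl hν (m + 1)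
  have hsmul : ∀ z : ℂ, z ≠ 0 →
      (z - 0) ^ 2 • structureMatrix ν (m + 1) z = besselNumerator l ν (m + 1) z := fun z hz => by
    rw [sub_zero, sq_smul_structureMatrix_besselWeight hc (m + 1) hz]
  refine ⟨structureMatrix ν (m + 1),
    isStructureMatrix_structureMatrix hdiff (fun z _ => besselWeight_const_ne_zero hc z) m,
    differentiableOn_of_pow_smul_eq hentire hsmul,
    hasPoleOfOrder_of_pow_smul_eq two_pos (fun i j => (hentire i j).analyticAt 0) (hzero ▸ hlead)
      (eventually_mem_nhdsWithin.mono hsmul), hlead, ?_⟩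
  simpa only [sub_zero, hzero] using tendsto_pow_smul_of_eq hentire hsmul

theorem mainTheorem7 (l : ℝ) (hl : 0 < l) (H : ℂ → ℂ) (hH : Differentiable ℂ H)
    (hν : OPUC.IsPositiveWeight (OPUC.besselWeight l H)) (n : ℕ) (hn : 1 ≤ n) :
    ∃ M : ℂ → Matrix (Fin 2) (Fin 2) ℂ,
      OPUC.IsStructureMatrix (OPUC.besselWeight l H) n M ∧
      (∀ i j, DifferentiableOn ℂ (fun z => M z i j) {0}ᶜ) ∧
      OPUC.HasPoleOfOrder M 2 0 ∧
      OPUC.besselLeadingCoeff l (OPUC.besselWeight l H) n ≠ 0 ∧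
      Tendsto (fun z : ℂ => z ^ 2 • M z) (𝓝[≠] 0)
        (𝓝 (OPUC.besselLeadingCoeff l (OPUC.besselWeight l H) n)) := by
  exact mainTheorem7_general l hl.ne' H hH hν n hn
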